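/- Throughout, sequences are real and indexed by $\mathbb{N}$, $\ell^0$ is the space of all real sequences, and $1<p<\infty$. A Köthe sequence space $\ell(c)$ is a linear subspace of $\ell^0$ with $\ell^1\subset\ell(c)$ such that $y\in\ell(c)$ whenever $x\in\ell(c)$ and $|y|\le|x|$ pointwise, endowed with a complete norm satisfying $\|x\|_{\ell(c)}\le\|y\|_{\ell(c)}$ whenever $x,y\in\ell(c)$ and $|x|\le|y|$ pointwise. It has the Fatou property if, whenever $x^k\in\ell(c)$, $0\le x^k\uparrow x$ pointwise and $\sup_k\|x^k\|_{\ell(c)}<\infty$, then $x\in\ell(c)$ and $\|x^k\|_{\ell(c)}\uparrow\|x\|_{\ell(c)}$. Let $\mathcal{P}_F(\mathbb{N})$ be the $\delta$-ring of finite subsets of $\mathbb{N}$ and let $m\colon\mathcal{P}_F(\mathbb{N})\to E$ be a vector measure with values in a Banach space $E$ such that $m(\{n\})\neq 0$ for all $n$. For $x^*\in E^*$ let $|x^*m|$ be the variation of the real measure $x^*m$, a measure on all subsets of $\mathbb{N}$. The space $\ell^1(m)$ consists of all $x\in\ell^0$ such that (i) $x\in L^1(|x^*m|)$ for every $x^*\in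 E^*$, and (ii) for every $A\subset\mathbb{N}$ there is a vector $v_A\in E$ with $x^*(v_A)=\int_A x\,d(x^*m)$ for every $x^*\in E^*$, where the integral of $x\in L^1(|x^*m|)$ over $A$ with respect to $x^*m$ is the limit of $\sum_j\alpha_j^{(n)}\,x^*m(A_j^{(n)}\cap A)$ for simple functions $\varphi_n=\sum_j\alpha^{(n)}_j\chi_{A^{(n)}_j}$, with finitely many summands and $A^{(n)}_j\in\mathcal{P}_F(\mathbb{N})$, converging to $x$ in $L^1(|x^*m|)$. For $q\in(0,\infty)$, $\ell^q(m)=\{x\in\ell^0:\ |x|^q\in\ell^1(m)\}$. **Proposition.** Let $\ell(c)$ be a Köthe sequence space with the Fatou property, and let $M=(a_{ij})_{i,j\in\mathbb{N}}$ be an infinite real matrix whose columns $C_j=(a_{ij})_i$ satisfy $C_j\ne0$ and $C_j\in\ell(c)$ for all $j$, and $\sup_j\|C_j\|_{\ell(c)}<\infty$. Write $Mx=\big(\sum_j a_{ij}x_j\big)_i$ whenever all these series converge, and let $m_M\colon\mathcal{P}_F(\mathbb{N})\to\ell(c)$ be the vector measure $m_M(A)=M\chi_A=\sum_{j\in A}C_j$.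 Then the following statements are equivalent: (a) $M$ defines a continuous linear operator $\ell^p\to\ell(c)$, that is, for every $x\in\ell^p$ the sequence $Mx$ is defined and belongs to $\ell(c)$, and $x\mapsto Mx$ is a continuous linear map $\ell^p\to\ell(c)$; (b) the operator defined by $M$ on $\ell^1$ has a continuous linear extension to $\ell^p$, that is, there is a continuous linear operator $S\colon\ell^p\to\ell(c)$ with $Sx=Mx$ for all $x\in\ell^1$; (c) $\ell^p\subset\ell^1(m_M)$; (d) $\ell^1\subset\ell^{1/p}(m_M)\cap\ell^1(m_M)$; (e) there exists $C>0$ such that $$\Big\|\sum_{j\in F}x_jC_j\Big\|_{\ell(c)}\le C\Big(\sum_{j\in F}x_j^p\Big)^{1/p}$$ for all finite $F\subset\mathbb{N}$ and all $(x_j)_{j\in F}\subset[0,\infty)$. -/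

import Mathlib

open Filter Topology MeasureTheory
open scoped ENNReal

/-! ### Vector measures on a `δ`-ring and their integrable functions -/

/-- A `δ`-ring of subsets of `Ω`: a ring of sets closed under countable intersections. -/
structure DeltaRing (Ω : Type*) where
  sets : Set (Set Ω)
  isSetRing : IsSetRing sets
  iInter_mem : ∀ A : ℕ → Set Ω, (∀ n, A n ∈ sets) → (⋂ n, A n) ∈ sets

namespace DeltaRing

variable {Ω : Type*}

/-- The `σ`-algebra of all `A ⊆ Ω` such that `A ∩ B` is in the `δ`-ring for every `B` in it. -/
abbrev loc (R : DeltaRing Ω) : MeasurableSpace Ω where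
  MeasurableSet' A := ∀ B ∈ R.sets, A ∩ B ∈ R.sets
  measurableSet_empty B _ := by simpa using R.isSetRing.empty_mem
  measurableSet_compl A hA B hB := by
    have h : Aᶜ ∩ B = B \ (A ∩ B) := by ext x; simp; tauto
    rw [h]
    exact R.isSetRing.sdiff_mem hB (hA B hB)
  measurableSet_iUnion A hA B hB := by
    have h : (⋃ n, A n) ∩ B = B \ ⋂ n, (B \ (A n ∩ B)) := by
      ext x
      simp only [Set.mem_inter_iff, Set.mem_iUnion, Set.mem_sdiff, Set.mem_iInter]
      constructor
      · rintro ⟨⟨n, hn⟩, hx⟩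
        exact ⟨hx, fun h => (h n).2 ⟨hn, hx⟩⟩
      · rintro ⟨hx, h⟩
        push Not at h
        obtain ⟨n, hn⟩ := h
        exact ⟨⟨n, (hn hx).1⟩, hx⟩
    rw [h]
    exact R.isSetRing.sdiff_mem hB
      (R.iInter_mem _ fun n => R.isSetRing.sdiff_mem hB (hA n B hB))

/-- The `δ`-ring of all finite subsets of `ℕ`. -/
def finiteSubsets : DeltaRing ℕ where
  sets := {A | A.Finite}
  isSetRing :=
    { empty_mem := Set.finite_empty
      union_mem := fun _ _ hs ht => Set.Finite.union hs ht
      sdiff_mem := fun _ _ hs _ => Set.Finite.sdiff hs }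
  iInter_mem A hA := (hA 0).subset (Set.iInter_subset A 0)

end DeltaRing

/-- A vector measure `m : R → E` on the `δ`-ring `R`: `∑ m(A n)` converges to `m(⋃ A n)` for all
pairwise disjoint `A n ∈ R` with `⋃ A n ∈ R`. Only the values on members of `R` are meaningful. -/
structure DeltaVectorMeasure {Ω : Type*} (R : DeltaRing Ω) (E : Type*)
    [NormedAddCommGroup E] where
  toFun : Set Ω → E
  hasSum_iUnion : ∀ A : ℕ → Set Ω, (∀ n, A n ∈ R.sets) → Pairwise (Function.onFun Disjoint A) →
    (⋃ n, A n) ∈ R.sets → HasSum (fun n => toFun (A n)) (toFun (⋃ n, A n))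

namespace DeltaVectorMeasure

variable {Ω : Type*} {R : DeltaRing Ω} {E : Type*} [NormedAddCommGroup E]

/-- `|m|(A) = sup ∑ ‖m (B j)‖` over the finite disjoint sequences `B 0, …, B (n - 1)` of members
of `R` contained in `A`. -/
noncomputable def variationFun (m : DeltaVectorMeasure R E) (A : Set Ω) : ℝ≥0∞ :=
  ⨆ (n : ℕ) (B : ℕ → Set Ω) (_ : (∀ j < n, B j ∈ R.sets ∧ B j ⊆ A) ∧
    ∀ j < n, ∀ k < n, j ≠ k → Disjoint (B j) (B k)), ∑ j ∈ Finset.range n, ‖m.toFun (B j)‖ₑ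

theorem le_variationFun (m : DeltaVectorMeasure R E) {A : Set Ω} (n : ℕ) (B : ℕ → Set Ω)
    (hB : ∀ j < n, B j ∈ R.sets ∧ B j ⊆ A)
    (hd : ∀ j < n, ∀ k < n, j ≠ k → Disjoint (B j) (B k)) :
    ∑ j ∈ Finset.range n, ‖m.toFun (B j)‖ₑ ≤ m.variationFun A :=
  le_iSup_of_le n (le_iSup_of_le B (le_iSup_of_le ⟨hB, hd⟩ le_rfl))

theorem toFun_empty (m : DeltaVectorMeasure R E) : m.toFun ∅ = 0 := by
  have h := m.hasSum_iUnion (fun _ => ∅) (fun _ => R.isSetRing.empty_mem)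
    (fun _ _ _ => disjoint_bot_left) (by simpa using R.isSetRing.empty_mem)
  have h2 := h.summable.tendsto_atTop_zero
  exact tendsto_nhds_unique tendsto_const_nhds h2

theorem variationFun_empty (m : DeltaVectorMeasure R E) : m.variationFun ∅ = 0 := by
  refine le_antisymm (iSup_le fun n => iSup_le fun B => iSup_le fun h => ?_) zero_le
  refine le_of_eq (Finset.sum_eq_zero fun j hj => ?_)
  rw [Set.subset_empty_iff.1 (h.1 j (Finset.mem_range.1 hj)).2, m.toFun_empty, enorm_zero]

theorem variationFun_mono (m : DeltaVectorMeasure R E) {A A' : Set Ω} (h : A ⊆ A') :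
    m.variationFun A ≤ m.variationFun A' :=
  iSup_le fun n => iSup_le fun B => iSup_le fun hB =>
    m.le_variationFun n B (fun j hj => ⟨(hB.1 j hj).1, (hB.1 j hj).2.trans h⟩) hB.2

theorem variationFun_add_le (m : DeltaVectorMeasure R E) {A A' : Set Ω} (h : Disjoint A A') :
    m.variationFun A + m.variationFun A' ≤ m.variationFun (A ∪ A') := by
  have key : ∀ (n : ℕ) (B : ℕ → Set Ω), ((∀ j < n, B j ∈ R.sets ∧ B j ⊆ A) ∧
      ∀ j < n, ∀ k < n, j ≠ k → Disjoint (B j) (B k)) →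
      ∀ (n' : ℕ) (B' : ℕ → Set Ω), ((∀ j < n', B' j ∈ R.sets ∧ B' j ⊆ A') ∧
      ∀ j < n', ∀ k < n', j ≠ k → Disjoint (B' j) (B' k)) →
      ∑ j ∈ Finset.range n, ‖m.toFun (B j)‖ₑ + ∑ j ∈ Finset.range n', ‖m.toFun (B' j)‖ₑ
        ≤ m.variationFun (A ∪ A') := by
    intro n B hB n' B' hB'
    have h1 := m.le_variationFun (A := A ∪ A') (n + n')
      (fun j => if j < n then B j else B' (j - n)) ?_ ?_
    · rw [Finset.sum_range_add] at h1
      refine le_trans (le_of_eq ?_) h1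
      congr 1
      · exact Finset.sum_congr rfl fun j hj => by simp [Finset.mem_range.1 hj]
      · exact Finset.sum_congr rfl fun j _ => by simp
    · intro j hj
      by_cases hjn : j < n
      · simpa [hjn] using
          ⟨(hB.1 j hjn).1, (hB.1 j hjn).2.trans Set.subset_union_left⟩
      · have := hB'.1 (j - n) (by omega)
        simpa [hjn] using ⟨this.1, this.2.trans Set.subset_union_right⟩
    · intro j hj k hk hjk
      by_cases hjn : j < n <;> by_cases hkn : k < n
      · simpa [hjn, hkn] using hB.2 j hjn k hkn hjk
      · simpa [hjn, hkn] using h.mono (hB.1 j hjn).2 (hB'.1 (k - n) (by omega)).2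
      · simpa [hjn, hkn] using (h.mono (hB.1 k hkn).2 (hB'.1 (j - n) (by omega)).2).symm
      · simpa [hjn, hkn] using hB'.2 (j - n) (by omega) (k - n) (by omega) (by omega)
  by_cases hA : m.variationFun A = ∞
  · rw [hA, top_add]
    exact hA ▸ m.variationFun_mono Set.subset_union_left
  refine add_le_of_le_tsub_left_of_le (m.variationFun_mono Set.subset_union_left) ?_
  refine iSup_le fun n' => iSup_le fun B' => iSup_le fun hB' => ?_
  refine ENNReal.le_sub_of_add_le_left hA ?_
  by_cases hs : ∑ j ∈ Finset.range n', ‖m.toFun (B' j)‖ₑ = ∞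
  · simpa [hs] using key 0 (fun _ => ∅) (by simp) n' B' hB'
  refine add_le_of_le_tsub_right_of_le ?_ ?_
  · simpa using key 0 (fun _ => ∅) (by simp) n' B' hB'
  · exact iSup_le fun n => iSup_le fun B => iSup_le fun hB =>
      ENNReal.le_sub_of_add_le_right hs (key n B hB n' B' hB')

theorem variationFun_iUnion (m : DeltaVectorMeasure R E) {A : ℕ → Set Ω}
    (hA : ∀ n, ∀ B ∈ R.sets, A n ∩ B ∈ R.sets) (hd : Pairwise (Function.onFun Disjoint A)) :
    m.variationFun (⋃ n, A n) = ∑' n, m.variationFun (A n) := by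
  refine le_antisymm (iSup_le fun n => iSup_le fun B => iSup_le fun hB => ?_) ?_
  · have h1 : ∀ j ∈ Finset.range n, ‖m.toFun (B j)‖ₑ ≤ ∑' i, ‖m.toFun (A i ∩ B j)‖ₑ := by
      intro j hj
      have hj := hB.1 j (Finset.mem_range.1 hj)
      have hU : (⋃ i, A i ∩ B j) = B j := by
        rw [← Set.iUnion_inter]; exact Set.inter_eq_right.2 hj.2
      have h := m.hasSum_iUnion (fun i => A i ∩ B j) (fun i => hA i _ hj.1)
        (fun i k hik => (hd hik).mono Set.inter_subset_left Set.inter_subset_left)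
        (by rw [hU]; exact hj.1)
      rw [hU] at h
      rw [← h.tsum_eq]
      exact enorm_tsum_le_tsum_enorm
    refine (Finset.sum_le_sum h1).trans ?_
    rw [← Summable.tsum_finsetSum fun _ _ => ENNReal.summable]
    refine ENNReal.tsum_le_tsum fun i => ?_
    refine m.le_variationFun n (fun j => A i ∩ B j)
      (fun j hj => ⟨hA i _ (hB.1 j hj).1, Set.inter_subset_left⟩)
      (fun j hj k hk hjk => (hB.2 j hj k hk hjk).mono Set.inter_subset_right
        Set.inter_subset_right)
  · refine ENNReal.tsum_le_of_sum_range_le fun n => ?_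
    have h : ∑ i ∈ Finset.range n, m.variationFun (A i) ≤
        m.variationFun (⋃ i ∈ Finset.range n, A i) := by
      induction n with
      | zero => simp
      | succ n ih =>
        rw [Finset.sum_range_succ]
        refine (add_le_add_left ih _).trans ((m.variationFun_add_le ?_).trans
          (m.variationFun_mono ?_))
        · simp only [Set.disjoint_iUnion_left, Finset.mem_range]
          exact fun i hi => hd (by omega)
        · intro x
          simp only [Set.mem_union, Set.mem_iUnion, Finset.mem_range, exists_prop]
          rintro (⟨i, hi, hx⟩ | hx)
          · exact ⟨i, by omega, hx⟩
          · exact ⟨n, by omega, hx⟩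
    exact h.trans (m.variationFun_mono (Set.iUnion₂_subset fun i _ => Set.subset_iUnion A i))

/-- The variation `|m|`, a measure on the `σ`-algebra `R.loc`. -/
noncomputable def variation (m : DeltaVectorMeasure R E) : @Measure Ω R.loc :=
  @Measure.ofMeasurable Ω R.loc (fun A _ => m.variationFun A) m.variationFun_empty
    (fun _ hA hd => m.variationFun_iUnion hA hd)

theorem variation_apply (m : DeltaVectorMeasure R E) {A : Set Ω}
    (hA : @MeasurableSet Ω R.loc A) : m.variation A = m.variationFun A :=
  @Measure.ofMeasurable_apply Ω R.loc _ _ _ A hA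

/-- The real measure `x' ∘ m` for a continuous linear functional `x'`. -/
def dualComp [NormedSpace ℝ E] (x' : StrongDual ℝ E) (m : DeltaVectorMeasure R E) :
    DeltaVectorMeasure R ℝ where
  toFun A := x' (m.toFun A)
  hasSum_iUnion A h1 h2 h3 := x'.hasSum (m.hasSum_iUnion A h1 h2 h3)

/-- `f ∈ L¹(lam) = L¹(|lam|)` for a real measure `lam`. -/
def IntegrableReal (lam : DeltaVectorMeasure R ℝ) (f : Ω → ℝ) : Prop :=
  @Integrable ℝ _ _ Ω R.loc f lam.variation

/-- The function `∑ α_B χ_B`, the sum running over the finitely many `B` with `α_B ≠ 0`. It is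
an `R`-simple function when all these `B` belong to `R`. -/
noncomputable def simpleFun (α : Set Ω →₀ ℝ) (ω : Ω) : ℝ :=
  ∑ B ∈ α.support, α B * B.indicator 1 ω

/-- The integral over `A` of the `R`-simple function `∑ α_B χ_B`, that is `∑ α_B lam(B ∩ A)`. -/
noncomputable def simpleIntegral (lam : DeltaVectorMeasure R ℝ) (α : Set Ω →₀ ℝ) (A : Set Ω) :
    ℝ :=
  ∑ B ∈ α.support, α B * lam.toFun (B ∩ A)

/-- `∫_A f d lam = y` for `f ∈ L¹(lam)`: the number `y` is the limit of `∫_A φ_n d lam` for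
`R`-simple functions `φ_n` that converge to `f` in `L¹(lam)`. -/
def HasIntegralReal (lam : DeltaVectorMeasure R ℝ) (f : Ω → ℝ) (A : Set Ω) (y : ℝ) : Prop :=
  ∃ α : ℕ → Set Ω →₀ ℝ, (∀ n, ∀ B ∈ (α n).support, B ∈ R.sets) ∧
    Tendsto (fun n => @lintegral Ω R.loc lam.variation fun ω => ‖simpleFun (α n) ω - f ω‖ₑ)
      atTop (𝓝 0) ∧
    Tendsto (fun n => lam.simpleIntegral (α n) A) atTop (𝓝 y)

/-- `f ∈ L¹(m)`: `f` is measurable, `f ∈ L¹(x' m)` for every `x' ∈ E*`, and for every `A` in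
`R.loc` there is a vector `x_A ∈ E` with `x'(x_A) = ∫_A f d(x' m)` for every `x' ∈ E*`. -/
def MemL1 [NormedSpace ℝ E] (m : DeltaVectorMeasure R E) (f : Ω → ℝ) : Prop :=
  @Measurable Ω ℝ R.loc _ f ∧
  (∀ x' : StrongDual ℝ E, (dualComp x' m).IntegrableReal f) ∧
  ∀ A : Set Ω, @MeasurableSet Ω R.loc A →
    ∃ xA : E, ∀ x' : StrongDual ℝ E, (dualComp x' m).HasIntegralReal f A (x' xA)

/-- The set `L^q(m)` of all functions `f` such that `|f|^q ∈ L¹(m)`, for `0 < q < ∞`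
(functions are not identified here when they are equal outside an `m`-null set). -/
def powL1 [NormedSpace ℝ E] (m : DeltaVectorMeasure R E) (q : ℝ) : Set (Ω → ℝ) :=
  {f | @Measurable Ω ℝ R.loc _ f ∧ m.MemL1 fun ω => |f ω| ^ q}

end DeltaVectorMeasure

/-! ### Köthe sequence spaces -/

/-- A Köthe sequence space: an ideal `X` of the space of all real sequences, with `ℓ¹ ⊆ X`,
endowed with a complete norm that is compatible with the pointwise order. -/
structure KotheSequenceSpace where
  carrier : Submodule ℝ (ℕ → ℝ)
  nrm : carrier → ℝ
  mem_of_abs_le : ∀ x ∈ carrier, ∀ y : ℕ → ℝ, (∀ n, |y n| ≤ |x n|) → y ∈ carrier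
  mem_of_memlp_one : ∀ x : ℕ → ℝ, Memℓp x 1 → x ∈ carrier
  nrm_nonneg : ∀ x, 0 ≤ nrm x
  nrm_eq_zero_iff : ∀ x, nrm x = 0 ↔ x = 0
  nrm_smul : ∀ (a : ℝ) (x : carrier), nrm (a • x) = |a| * nrm x
  nrm_add_le : ∀ x y : carrier, nrm (x + y) ≤ nrm x + nrm y
  nrm_le_of_abs_le : ∀ x y : carrier, (∀ n, |x.1 n| ≤ |y.1 n|) → nrm x ≤ nrm y
  complete : ∀ u : ℕ → carrier,
    (∀ ε > 0, ∃ N, ∀ k ≥ N, ∀ l ≥ N, nrm (u k - u l) < ε) →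
    ∃ x : carrier, Tendsto (fun k => nrm (u k - x)) atTop (𝓝 0)

namespace KotheSequenceSpace

/-- The space `X` as a type; it carries the topology of its norm, not that of pointwise
convergence. -/
def Elem (X : KotheSequenceSpace) : Type := X.carrier

variable (X : KotheSequenceSpace)

noncomputable instance : AddCommGroup X.Elem := inferInstanceAs (AddCommGroup X.carrier)

noncomputable instance : Module ℝ X.Elem := inferInstanceAs (Module ℝ X.carrier)

noncomputable instance : Norm X.Elem := ⟨X.nrm⟩

instance : CoeFun X.Elem fun _ => ℕ → ℝ := ⟨fun x => x.1⟩

theorem core : NormedSpace.Core ℝ X.Elem where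
  norm_nonneg := X.nrm_nonneg
  norm_smul := X.nrm_smul
  norm_triangle := X.nrm_add_le
  norm_eq_zero_iff := X.nrm_eq_zero_iff

noncomputable instance : NormedAddCommGroup X.Elem := NormedAddCommGroup.ofCore X.core

noncomputable instance : NormedSpace ℝ X.Elem := NormedSpace.ofCore X.core

instance : CompleteSpace X.Elem := by
  refine Metric.complete_of_cauchySeq_tendsto fun u hu => ?_
  obtain ⟨x, hx⟩ := X.complete u fun ε hε => by
    obtain ⟨N, hN⟩ := Metric.cauchySeq_iff.1 hu ε hε
    refine ⟨N, fun k hk l hl => ?_⟩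
    have h := hN k hk l hl
    rw [dist_eq_norm] at h
    exact h
  exact ⟨x, tendsto_iff_norm_sub_tendsto_zero.2 hx⟩

/-- The Fatou property: if `x^k ∈ X`, `0 ≤ x^k ↑ x` pointwise and `sup ‖x^k‖ < ∞`, then `x ∈ X`
and `‖x^k‖ ↑ ‖x‖`. -/
def FatouProperty : Prop :=
  ∀ (u : ℕ → X.Elem) (x : ℕ → ℝ), (∀ k n, 0 ≤ u k n) → (∀ n, Monotone fun k => u k n) →
    (∀ n, Tendsto (fun k => u k n) atTop (𝓝 (x n))) →
    BddAbove (Set.range fun k => ‖u k‖) →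
    ∃ y : X.Elem, (∀ n, y n = x n) ∧ (Monotone fun k => ‖u k‖) ∧
      Tendsto (fun k => ‖u k‖) atTop (𝓝 ‖y‖)

end KotheSequenceSpace

/-! ### Infinite matrices -/

/-- `M x = y`: for every `i` the series `∑_j a_{ij} x_j` converges, with sum `y_i`. -/
def MatrixMapsTo (M : Matrix ℕ ℕ ℝ) (x y : ℕ → ℝ) : Prop :=
  ∀ i, Tendsto (fun k => ∑ j ∈ Finset.range k, M i j * x j) atTop (𝓝 (y i))

/-- The `j`-th column of `M` as an element of `X`. -/
def colElem (X : KotheSequenceSpace) (M : Matrix ℕ ℕ ℝ) (hM : ∀ j, M.col j ∈ X.carrier)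
    (j : ℕ) : X.Elem := ⟨M.col j, hM j⟩

/-- The vector measure `m_M : A ↦ M χ_A = ∑_{j ∈ A} C_j` on the finite subsets `A` of `ℕ`, where
`C_j` is the `j`-th column of `M`. -/
noncomputable def matrixMeasure (X : KotheSequenceSpace) (M : Matrix ℕ ℕ ℝ)
    (hM : ∀ j, M.col j ∈ X.carrier) :
    DeltaVectorMeasure DeltaRing.finiteSubsets X.Elem where
  toFun A := ∑ᶠ j ∈ A, colElem X M hM j
  hasSum_iUnion A hA hd hU := by
    classical
    set v := colElem X M hM
    have hU' : (⋃ n, A n).Finite := hU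
    have key : ∀ B : Set ℕ, B ⊆ ⋃ n, A n →
        ∑ᶠ j ∈ B, v j = ∑ j ∈ hU'.toFinset, if j ∈ B then v j else 0 := by
      intro B hB
      rw [← Finset.sum_filter, finsum_mem_eq_finite_toFinset_sum v (hU'.subset hB)]
      refine Finset.sum_congr ?_ fun _ _ => rfl
      ext j
      simpa using fun hj => Set.mem_iUnion.1 (hB hj)
    rw [key _ subset_rfl]
    simp_rw [fun n => key (A n) (Set.subset_iUnion A n)]
    refine hasSum_sum fun j hj => ?_
    rw [Set.Finite.mem_toFinset] at hj
    obtain ⟨n, hn⟩ := Set.mem_iUnion.1 hj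
    have h := hasSum_single (f := fun k => if j ∈ A k then v j else 0) n fun k hk => by
      have : j ∉ A k := fun h => Set.disjoint_left.1 (hd hk) h hn
      simp [this]
    simpa [hn, hj] using h

/-- `m_M(A) = M χ_A`. -/
theorem matrixMapsTo_matrixMeasure (X : KotheSequenceSpace) (M : Matrix ℕ ℕ ℝ)
    (hM : ∀ j, M.col j ∈ X.carrier) (A : Set ℕ) (hA : A.Finite) :
    MatrixMapsTo M (A.indicator 1) ((matrixMeasure X M hM).toFun A) := by
  classical
  intro i
  let ev : X.Elem →+ ℝ :=
    { toFun := fun x => x i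
      map_zero' := rfl
      map_add' := fun _ _ => rfl }
  have h1 : ((matrixMeasure X M hM).toFun A) i = ∑ j ∈ hA.toFinset, M i j := by
    have h : (matrixMeasure X M hM).toFun A = ∑ j ∈ hA.toFinset, colElem X M hM j :=
      finsum_mem_eq_finite_toFinset_sum _ hA
    rw [h]
    exact map_sum ev _ _
  rw [h1]
  have h2 := (hasSum_sum_of_ne_finset_zero (f := fun j => M i j * A.indicator 1 j)
    (s := hA.toFinset) fun j hj => by
      have : j ∉ A := by simpa using hj
      simp [this]).tendsto_sum_nat
  convert h2 using 2
  exact Finset.sum_congr rfl fun j hj => by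
    have : j ∈ A := by simpa using hj
    simp [this]

/-! Everything is routed through the upper `p`-estimate (e), along the cycles (a) → (b) → (e) → (a)
and (e) → (c) → (d) → (e). Given (e), the series `∑ x j • C_j` satisfies the unconditional Cauchy
criterion for each `x ∈ ℓ^p`. Its sums form the bounded operator of (a), and its subseries supply
the vectors that (c) asks for. An extension as in (b) returns (e) when tested on finitely supported
vectors. The return from (d) is the substantial step: on finite subsets of `ℕ` each measure `x'm` is
atomic, so integrability means absolute convergence of `∑ x j * x'(C_j)` for each functional `x'`.
If (e) failed, normalised bad blocks could be summed to one nonnegative `x ∈ ℓ^p`, against the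
uniform bound that Banach–Steinhaus gives (`exists_norm_sum_le_of_weakly_summable`,
`exists_hasUpperEstimate_of_weakly_summable`). The link between (c) and (d) is that `x ↦ |x|^(1/p)`
sends `ℓ¹` into `ℓ^p`. -/

/-! ### Series `∑ x j • v j` with coefficients in `ℓ^p` -/

section Series

variable {E : Type*} [NormedAddCommGroup E] [NormedSpace ℝ E]

/-- The upper `p`-estimate `‖∑ x j • v j‖ ≤ C ‖x‖_p` for finite sums with nonnegative
coefficients. -/
def HasUpperEstimate (v : ℕ → E) (q C : ℝ) : Prop :=
  ∀ (s : Finset ℕ) (x : ℕ → ℝ), (∀ j ∈ s, 0 ≤ x j) →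
    ‖∑ j ∈ s, x j • v j‖ ≤ C * (∑ j ∈ s, x j ^ q) ^ (1 / q)

/-- The positive and negative parts of `x` are both dominated by `|x|`; the factor 2 is the price of
treating them separately. -/
theorem HasUpperEstimate.norm_sum_le {v : ℕ → E} {q C : ℝ} (h : HasUpperEstimate v q C)
    (hq : 0 < q) (hC : 0 ≤ C) (s : Finset ℕ) (x : ℕ → ℝ) :
    ‖∑ j ∈ s, x j • v j‖ ≤ 2 * C * (∑ j ∈ s, |x j| ^ q) ^ (1 / q) := by
  have key : ∀ y : ℕ → ℝ, (∀ j, 0 ≤ y j ∧ y j ≤ |x j|) →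
      ‖∑ j ∈ s, y j • v j‖ ≤ C * (∑ j ∈ s, |x j| ^ q) ^ (1 / q) := fun y hy => by
    refine (h s y fun j _ => (hy j).1).trans ?_
    have h0 : ∀ j ∈ s, 0 ≤ y j ^ q := fun j _ => Real.rpow_nonneg (hy j).1 q
    refine mul_le_mul_of_nonneg_left (Real.rpow_le_rpow (Finset.sum_nonneg h0)
      (Finset.sum_le_sum fun j _ => Real.rpow_le_rpow (hy j).1 (hy j).2 hq.le)
      (by positivity)) hC
  have hx : ∑ j ∈ s, x j • v j =
      ∑ j ∈ s, (max (x j) 0) • v j - ∑ j ∈ s, (max (-x j) 0) • v j := by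
    rw [← Finset.sum_sub_distrib]
    refine Finset.sum_congr rfl fun j _ => ?_
    rw [← sub_smul]
    congr 1
    rcases le_total 0 (x j) with h | h <;> simp [h]
  rw [hx]
  have h1 := key (fun j => max (x j) 0)
    fun j => ⟨le_max_right _ _, max_le (le_abs_self _) (abs_nonneg _)⟩
  have h2 := key (fun j => max (-x j) 0)
    fun j => ⟨le_max_right _ _, max_le (neg_le_abs _) (abs_nonneg _)⟩
  linarith [norm_sub_le (∑ j ∈ s, (max (x j) 0) • v j) (∑ j ∈ s, (max (-x j) 0) • v j)]

theorem HasUpperEstimate.summable [CompleteSpace E] {v : ℕ → E} {q C : ℝ}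
    (h : HasUpperEstimate v q C) (hq : 0 < q) (hC : 0 < C) {x : ℕ → ℝ}
    (hx : Summable fun j => |x j| ^ q) : Summable fun j => x j • v j := by
  rw [summable_iff_vanishing_norm]
  intro ε hε
  -- A tail of `∑ |x j| ^ q` below this threshold makes `2 * C` times its `q`-th root smaller than
  -- `ε`.
  obtain ⟨s, hs⟩ := summable_iff_vanishing_norm.1 hx ((ε / (2 * C)) ^ q) (by positivity)
  refine ⟨s, fun t ht => (h.norm_sum_le hq hC.le t x).trans_lt ?_⟩
  have h0 : 0 ≤ ∑ j ∈ t, |x j| ^ q := Finset.sum_nonneg fun j _ => by positivity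
  have h1 := hs t ht
  rw [Real.norm_of_nonneg h0] at h1
  have h2 : (∑ j ∈ t, |x j| ^ q) ^ (1 / q) < ε / (2 * C) := by
    rw [one_div, Real.rpow_inv_lt_iff_of_pos h0 (by positivity) hq]
    exact h1
  rwa [lt_div_iff₀' (by positivity)] at h2

/-- The operator `x ↦ ∑ x j • v j` on `ℓ^p`. -/
theorem HasUpperEstimate.exists_clm [CompleteSpace E] {v : ℕ → E} {p : ℝ≥0∞} [Fact (1 ≤ p)]
    {C : ℝ} (h : HasUpperEstimate v p.toReal C) (hp : 0 < p.toReal) (hC : 0 < C) :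
    ∃ S : lp (fun _ : ℕ => ℝ) p →L[ℝ] E, ∀ x, HasSum (fun j => x j • v j) (S x) := by
  have hs : ∀ x : lp (fun _ : ℕ => ℝ) p, Summable fun j => x j • v j := fun x =>
    h.summable hp hC ((lp.memℓp x).summable hp)
  let T : lp (fun _ : ℕ => ℝ) p →ₗ[ℝ] E :=
    { toFun := fun x => ∑' j, x j • v j
      map_add' := fun x y => by
        rw [← (hs x).tsum_add (hs y)]
        exact tsum_congr fun j => add_smul _ _ _
      map_smul' := fun a x => by
        rw [RingHom.id_apply, ← (hs x).tsum_const_smul]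
        exact tsum_congr fun j => mul_smul _ _ _ }
  refine ⟨T.mkContinuous (2 * C) fun x => ?_, fun x => (hs x).hasSum⟩
  refine le_of_tendsto (hs x).hasSum.norm (Eventually.of_forall fun s => ?_)
  refine (h.norm_sum_le hp hC.le s x).trans ?_
  gcongr
  rw [one_div, Real.rpow_inv_le_iff_of_pos (Finset.sum_nonneg fun j _ => by positivity)
    (norm_nonneg _) hp]
  exact lp.sum_rpow_le_norm_rpow hp x s

theorem lp_norm_sum_single {p : ℝ≥0∞} (hp : 0 < p.toReal) (s : Finset ℕ) (x : ℕ → ℝ)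
    (hx : ∀ j ∈ s, 0 ≤ x j) :
    ‖∑ j ∈ s, (lp.single p j (x j) : lp (fun _ : ℕ => ℝ) p)‖ =
      (∑ j ∈ s, x j ^ p.toReal) ^ (1 / p.toReal) := by
  have h := lp.norm_sum_single (E := fun _ : ℕ => ℝ) hp x s
  have h1 : ∑ j ∈ s, ‖x j‖ ^ p.toReal = ∑ j ∈ s, x j ^ p.toReal :=
    Finset.sum_congr rfl fun j hj => by rw [Real.norm_of_nonneg (hx j hj)]
  rw [← h1, ← h, one_div, Real.rpow_rpow_inv (lp.norm_nonneg' _) hp.ne']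

theorem lp_sum_single_apply {p : ℝ≥0∞} (s : Finset ℕ) (x : ℕ → ℝ) (i : ℕ) :
    (∑ j ∈ s, (lp.single p j (x j) : lp (fun _ : ℕ => ℝ) p)) i = if i ∈ s then x i else 0 := by
  rw [lp.coeFn_sum, Finset.sum_apply]
  simp only [lp.coeFn_single]
  exact Finset.sum_pi_single i x s

/-- If `∑ x j • v j` is weakly absolutely convergent, then its finite sums with smaller nonnegative
coefficients are bounded in norm. -/
theorem exists_norm_sum_le_of_weakly_summable {v : ℕ → E} {x : ℕ → ℝ}
    (h : ∀ f : StrongDual ℝ E, Summable fun j => x j * |f (v j)|) :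
    ∃ B, ∀ (s : Finset ℕ) (y : ℕ → ℝ), (∀ j ∈ s, 0 ≤ y j ∧ y j ≤ x j) →
      ‖∑ j ∈ s, y j • v j‖ ≤ B := by
  let ι := {z : Finset ℕ × (ℕ → ℝ) // ∀ j ∈ z.1, 0 ≤ z.2 j ∧ z.2 j ≤ x j}
  -- The finite sums act as functionals on the complete space `E*`. The coefficients `y` belong to
  -- the index, so the bound is uniform in them.
  obtain ⟨B, hB⟩ := banach_steinhaus (ι := ι)
    (g := fun z => NormedSpace.inclusionInDoubleDual ℝ E (∑ j ∈ z.1.1, z.1.2 j • v j)) fun f => by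
      refine ⟨∑' j, abs (x j * |f (v j)|), fun ⟨⟨s, y⟩, hz⟩ => ?_⟩
      rw [NormedSpace.dual_def, map_sum]
      refine (norm_sum_le _ _).trans ((Finset.sum_le_sum fun j hj => ?_).trans
        ((h f).abs.sum_le_tsum s fun j _ => abs_nonneg _))
      obtain ⟨h1, h2⟩ := hz j hj
      rw [map_smul, norm_smul, Real.norm_of_nonneg h1]
      exact (mul_le_mul_of_nonneg_right h2 (abs_nonneg _)).trans (le_abs_self _)
  refine ⟨B, fun s y hy => ?_⟩
  rw [← (NormedSpace.inclusionInDoubleDualLi (E := E) ℝ).norm_map]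
  exact hB ⟨(s, y), hy⟩

/-- Weak absolute convergence of `∑ x j • v j` for every nonnegative `x ∈ ℓ^p` yields an upper
`p`-estimate. -/
theorem exists_hasUpperEstimate_of_weakly_summable {v : ℕ → E} {p : ℝ≥0∞} [Fact (1 ≤ p)]
    (hp : 0 < p.toReal)
    (h : ∀ x : ℕ → ℝ, (∀ j, 0 ≤ x j) → Memℓp x p →
      ∀ f : StrongDual ℝ E, Summable fun j => x j * |f (v j)|) :
    ∃ C : ℝ, 0 < C ∧ HasUpperEstimate v p.toReal C := by
  by_contra! hcon
  -- The estimate fails with constant `4 ^ n`; rescaling the witness to `ℓ^p` norm `2 ^ (-n)` leaves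
  -- a sum of norm above `4 ^ n * 2 ^ (-n) = 2 ^ n`.
  have hbad : ∀ n : ℕ, ∃ (s : Finset ℕ) (x : ℕ → ℝ), (∀ j ∈ s, 0 ≤ x j) ∧
      (∑ j ∈ s, x j ^ p.toReal) ^ (1 / p.toReal) = (1 / 2) ^ n ∧
      2 ^ n < ‖∑ j ∈ s, x j • v j‖ := by
    intro n
    have h1 := hcon (4 ^ n) (by positivity)
    simp only [HasUpperEstimate, not_forall, not_le] at h1
    obtain ⟨s, x, hx, hlt⟩ := h1
    have h0 : ∀ j ∈ s, 0 ≤ x j ^ p.toReal := fun j hj => Real.rpow_nonneg (hx j hj) _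
    set N := (∑ j ∈ s, x j ^ p.toReal) ^ (1 / p.toReal) with hN
    have hN0 : 0 ≤ N := Real.rpow_nonneg (Finset.sum_nonneg h0) _
    have hNpos : 0 < N := by
      refine hN0.lt_of_ne fun hz => ?_
      rw [hN, eq_comm, Real.rpow_eq_zero (Finset.sum_nonneg h0) (by positivity),
        Finset.sum_eq_zero_iff_of_nonneg h0] at hz
      have : ∑ j ∈ s, x j • v j = 0 := Finset.sum_eq_zero fun j hj => by
        rw [(Real.rpow_eq_zero (hx j hj) hp.ne').1 (hz j hj), zero_smul]
      rw [this, norm_zero] at hlt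
      exact absurd hlt (not_lt.2 (by positivity))
    set c : ℝ := (1 / 2) ^ n / N with hc
    have hc0 : 0 < c := by positivity
    refine ⟨s, fun j => c * x j, fun j hj => mul_nonneg hc0.le (hx j hj), ?_, ?_⟩
    · rw [Finset.sum_congr rfl fun j hj => Real.mul_rpow hc0.le (hx j hj), ← Finset.mul_sum,
        Real.mul_rpow (by positivity) (Finset.sum_nonneg h0), one_div,
        Real.rpow_rpow_inv hc0.le hp.ne', ← one_div, ← hN, hc, div_mul_cancel₀ _ hNpos.ne']
    · simp_rw [mul_smul]
      rw [← Finset.smul_sum, norm_smul, Real.norm_of_nonneg hc0.le]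
      have h2 := mul_lt_mul_of_pos_left hlt hc0
      refine lt_of_eq_of_lt ?_ h2
      rw [hc, show (4 : ℝ) = 2 * 2 by norm_num, mul_pow, one_div, inv_pow]
      field_simp
  choose s x hx hN hlt using hbad
  let Y : ℕ → lp (fun _ : ℕ => ℝ) p := fun n => ∑ j ∈ s n, lp.single p j (x n j)
  have hY : Summable Y := by
    refine Summable.of_norm ?_
    simp_rw [Y, fun n => lp_norm_sum_single hp (s n) (x n) (hx n), hN]
    exact summable_geometric_two
  have hY0 : ∀ n j, 0 ≤ Y n j := fun n j => by
    simp only [Y, lp_sum_single_apply]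
    split_ifs with hj
    exacts [hx n j hj, le_rfl]
  -- All blocks are nonnegative, so `∑' n, Y n` dominates each of them coordinatewise; the bound `B`
  -- obtained for this one sequence then applies to every block.
  have hcoord : ∀ j, HasSum (fun n => Y n j) ((∑' n, Y n : lp (fun _ : ℕ => ℝ) p) j) := fun j =>
    hY.hasSum.mapL (lp.evalCLM ℝ (fun _ : ℕ => ℝ) p j)
  obtain ⟨B, hB⟩ := exists_norm_sum_le_of_weakly_summable
    (h _ (fun j => (hcoord j).nonneg fun n => hY0 n j) (lp.memℓp (∑' n, Y n)))
  obtain ⟨n, hn⟩ := pow_unbounded_of_one_lt B (one_lt_two (α := ℝ))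
  refine absurd (hB (s n) (x n) fun j hj => ⟨hx n j hj, ?_⟩) (not_le.2 (hn.trans (hlt n)))
  have h1 := le_hasSum (hcoord j) n fun k _ => hY0 k j
  simp only [Y, lp_sum_single_apply, if_pos hj] at h1
  exact h1

end Series
/-! ### Integrability with respect to a vector measure on the finite subsets of `ℕ` -/

namespace DeltaVectorMeasure

variable {E : Type*} [NormedAddCommGroup E]

theorem measurableSet_loc_finiteSubsets (A : Set ℕ) :
    @MeasurableSet ℕ DeltaRing.finiteSubsets.loc A :=
  fun _ hB => Set.Finite.subset hB Set.inter_subset_right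

theorem measurable_loc_finiteSubsets {β : Type*} [MeasurableSpace β] (f : ℕ → β) :
    @Measurable ℕ β DeltaRing.finiteSubsets.loc _ f :=
  fun _ _ => measurableSet_loc_finiteSubsets _

/-- Among pairwise disjoint subsets of a singleton at most one is nonempty. -/
theorem variationFun_singleton (m : DeltaVectorMeasure DeltaRing.finiteSubsets E) (j : ℕ) :
    m.variationFun {j} = ‖m.toFun {j}‖ₑ := by
  refine le_antisymm (iSup_le fun n => iSup_le fun B => iSup_le fun hB => ?_) ?_
  · by_cases h : ∃ k < n, B k = {j}
    · obtain ⟨k, hk, hkj⟩ := h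
      rw [Finset.sum_eq_single_of_mem k (Finset.mem_range.2 hk), hkj]
      intro i hi hik
      have hi := Finset.mem_range.1 hi
      have h1 : Disjoint (B i) (B i) :=
        (hB.2 i hi k hk hik).mono_right (hkj ▸ (hB.1 i hi).2)
      rw [disjoint_self.1 h1, Set.bot_eq_empty, m.toFun_empty, enorm_zero]
    · rw [Finset.sum_eq_zero]
      · exact zero_le
      · intro i hi
        have hi := Finset.mem_range.1 hi
        rcases Set.subset_singleton_iff_eq.1 (hB.1 i hi).2 with h1 | h1
        · rw [h1, m.toFun_empty, enorm_zero]
        · exact absurd ⟨i, hi, h1⟩ h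
  · have h := m.le_variationFun (A := {j}) 1 (fun _ => {j})
      (fun _ _ => ⟨Set.finite_singleton j, subset_rfl⟩) (fun i hi k hk hik => by omega)
    simpa using h

/-- All subsets of `ℕ` are measurable for `loc`, and the variation is the sum of its atoms; `L¹`
conditions thus become conditions on weighted series. -/
theorem lintegral_variation (m : DeltaVectorMeasure DeltaRing.finiteSubsets E) (f : ℕ → ℝ≥0∞) :
    @lintegral ℕ DeltaRing.finiteSubsets.loc m.variation f = ∑' j, f j * ‖m.toFun {j}‖ₑ := by
  let _ : MeasurableSpace ℕ := DeltaRing.finiteSubsets.loc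
  have : MeasurableSingletonClass ℕ := ⟨fun _ => measurableSet_loc_finiteSubsets _⟩
  rw [lintegral_countable']
  refine tsum_congr fun j => ?_
  rw [m.variation_apply (measurableSet_loc_finiteSubsets _), m.variationFun_singleton]

theorem integrableReal_iff_summable (lam : DeltaVectorMeasure DeltaRing.finiteSubsets ℝ)
    (x : ℕ → ℝ) : lam.IntegrableReal x ↔ Summable fun j => |x j * lam.toFun {j}| := by
  let _ : MeasurableSpace ℕ := DeltaRing.finiteSubsets.loc
  have h : lam.IntegrableReal x ↔ ∑' j, ‖x j * lam.toFun {j}‖ₑ < ∞ := by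
    rw [IntegrableReal, Integrable,
      and_iff_right (measurable_loc_finiteSubsets x).aestronglyMeasurable,
      hasFiniteIntegral_iff_enorm, lintegral_variation]
    simp_rw [enorm_mul]
  rw [h, lt_top_iff_ne_top]
  simp_rw [← ofReal_norm, ← Real.norm_eq_abs]
  refine ⟨fun h => ?_, fun h => h.tsum_ofReal_ne_top⟩
  have h1 := ENNReal.summable_toReal h
  simpa only [ENNReal.toReal_ofReal (norm_nonneg _)] using h1

/-- The coefficients of the simple function `∑ j < n, x j • χ_{j}`. -/
noncomputable def truncCoeff (x : ℕ → ℝ) (n : ℕ) : Set ℕ →₀ ℝ :=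
  ∑ j ∈ Finset.range n, Finsupp.single {j} (x j)

theorem sum_support_truncCoeff (x : ℕ → ℝ) (n : ℕ) (g : Set ℕ → ℝ) :
    ∑ B ∈ (truncCoeff x n).support, truncCoeff x n B * g B =
      ∑ j ∈ Finset.range n, x j * g {j} := by
  -- `Finsupp.sum` is additive in the coefficients, so indices with `x j = 0`, which leave no trace
  -- in the support, need no separate case.
  change (truncCoeff x n).sum (fun B a => a * g B) = _
  rw [truncCoeff, ← Finsupp.sum_finsetSum_index (by simp) (by intros; ring)]
  simp

theorem simpleFun_truncCoeff (x : ℕ → ℝ) (n i : ℕ) :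
    simpleFun (truncCoeff x n) i = if i < n then x i else 0 := by
  rw [simpleFun, sum_support_truncCoeff x n fun B => B.indicator 1 i]
  simp [Set.indicator_apply]

theorem finite_of_mem_support_truncCoeff {x : ℕ → ℝ} {n : ℕ} {B : Set ℕ}
    (hB : B ∈ (truncCoeff x n).support) : B.Finite := by
  classical
  obtain ⟨j, -, hj⟩ := Finset.mem_biUnion.1 (Finsupp.support_finsetSum hB)
  rw [Finset.mem_singleton.1 (Finsupp.support_single_subset hj)]
  exact Set.finite_singleton j

/-- The truncations of `x` are the approximating simple functions: they converge in `L¹` by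
domination by `|x|`, and their integrals over `A` are the partial sums of the given series. -/
theorem HasIntegralReal.of_hasSum {lam : DeltaVectorMeasure DeltaRing.finiteSubsets ℝ}
    {x : ℕ → ℝ} (hx : lam.IntegrableReal x) {A : Set ℕ} {y : ℝ}
    (hy : HasSum (A.indicator fun j => x j * lam.toFun {j}) y) : lam.HasIntegralReal x A y := by
  classical
  let _ : MeasurableSpace ℕ := DeltaRing.finiteSubsets.loc
  refine ⟨truncCoeff x, fun n B hB => finite_of_mem_support_truncCoeff hB, ?_, ?_⟩
  · have h := tendsto_lintegral_of_dominated_convergence (μ := lam.variation)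
      (F := fun n ω => ‖simpleFun (truncCoeff x n) ω - x ω‖ₑ) (f := fun _ => 0)
      (fun ω => ‖x ω‖ₑ) (fun n => measurable_loc_finiteSubsets _)
      (fun n => Eventually.of_forall fun ω => ?_) hx.hasFiniteIntegral.ne
      (Eventually.of_forall fun ω => ?_)
    · simpa using h
    · simp only [simpleFun_truncCoeff]
      split_ifs <;> simp
    · refine tendsto_const_nhds.congr' ?_
      filter_upwards [eventually_gt_atTop ω] with n hn
      simp [simpleFun_truncCoeff, hn]
  · refine hy.tendsto_sum_nat.congr fun n => ?_
    rw [simpleIntegral, sum_support_truncCoeff x n fun B => lam.toFun (B ∩ A)]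
    refine Finset.sum_congr rfl fun j _ => ?_
    by_cases hj : j ∈ A
    · rw [Set.indicator_of_mem hj, Set.inter_eq_left.2 (Set.singleton_subset_iff.2 hj)]
    · rw [Set.indicator_of_notMem hj, Set.singleton_inter_eq_empty.2 hj, lam.toFun_empty, mul_zero]

variable [NormedSpace ℝ E]

theorem MemL1.summable {m : DeltaVectorMeasure DeltaRing.finiteSubsets E} {x : ℕ → ℝ}
    (h : m.MemL1 x) (f : StrongDual ℝ E) : Summable fun j => |x j * f (m.toFun {j})| := by
  obtain ⟨-, hint, -⟩ := h
  exact (integrableReal_iff_summable (dualComp f m) x).1 (hint f)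

/-- In a complete space every subseries of an unconditionally convergent series converges; the sum
over `A` serves as `xA`. -/
theorem MemL1.of_summable [CompleteSpace E] {m : DeltaVectorMeasure DeltaRing.finiteSubsets E}
    {x : ℕ → ℝ} (h : Summable fun j => x j • m.toFun {j}) : m.MemL1 x := by
  have hint : ∀ f : StrongDual ℝ E, (dualComp f m).IntegrableReal x := fun f => by
    rw [integrableReal_iff_summable]
    refine ((h.mapL f).abs).congr fun j => ?_
    rw [map_smul, smul_eq_mul]; rfl
  refine ⟨measurable_loc_finiteSubsets x, hint, fun A _ => ?_⟩
  refine ⟨∑' j, A.indicator (fun j => x j • m.toFun {j}) j, fun f => .of_hasSum (hint f) ?_⟩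
  have h1 := (h.indicator A).hasSum.mapL f
  rw [show (A.indicator fun j => x j * (dualComp f m).toFun {j}) =
    fun j => f (A.indicator (fun j => x j • m.toFun {j}) j) from funext fun j => ?_]
  · exact h1
  by_cases hj : j ∈ A <;> simp [hj, dualComp]

end DeltaVectorMeasure

/-! ### Continuity of coordinates in a Köthe space -/

namespace KotheSequenceSpace

variable (X : KotheSequenceSpace)

theorem exists_unit_mem (i : ℕ) : ∃ e : X.Elem, e i = 1 ∧ ∀ j ≠ i, e j = 0 :=
  ⟨⟨Pi.single i 1, X.mem_of_memlp_one _ (lp.memℓp (lp.single (E := fun _ : ℕ => ℝ) 1 i 1))⟩,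
    Pi.single_eq_same _ _, fun _ hj => Pi.single_eq_of_ne hj _⟩

/-- The `i`-th coordinate as a continuous linear functional. -/
theorem exists_coord (i : ℕ) : ∃ f : StrongDual ℝ X.Elem, ∀ x : X.Elem, f x = x i := by
  obtain ⟨e, he1, he0⟩ := X.exists_unit_mem i
  have he : 0 < ‖e‖ := by
    refine norm_pos_iff.2 fun h => ?_
    rw [h] at he1
    exact zero_ne_one he1
  let T : X.Elem →ₗ[ℝ] ℝ :=
    { toFun := fun x => x i
      map_add' := fun _ _ => rfl
      map_smul' := fun _ _ => rfl }
  refine ⟨T.mkContinuous ‖e‖⁻¹ fun x => ?_, fun x => rfl⟩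
  rw [inv_mul_eq_div, le_div_iff₀ he]
  -- Cutting `x` down to its `i`-th coordinate decreases it pointwise in absolute value, hence in
  -- norm.
  have h1 : ‖x i • e‖ ≤ ‖x‖ := X.nrm_le_of_abs_le _ _ fun n => by
    change |x i * e n| ≤ |x n|
    rcases eq_or_ne n i with rfl | hn
    · rw [he1, mul_one]
    · rw [he0 n hn, mul_zero, abs_zero]
      exact abs_nonneg _
  rwa [norm_smul] at h1

theorem hasSum_coord {u : ℕ → X.Elem} {y : X.Elem} (h : HasSum u y) (i : ℕ) :
    HasSum (fun j => u j i) (y i) := by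
  obtain ⟨f, hf⟩ := X.exists_coord i
  simpa only [hf] using h.mapL f

end KotheSequenceSpace

/-! ### Matrix operators and the equivalences -/

theorem matrixMeasure_singleton (X : KotheSequenceSpace) (M : Matrix ℕ ℕ ℝ)
    (hM : ∀ j, M.col j ∈ X.carrier) (j : ℕ) :
    (matrixMeasure X M hM).toFun {j} = colElem X M hM j :=
  finsum_mem_singleton

theorem matrixMapsTo_of_hasSum {X : KotheSequenceSpace} {M : Matrix ℕ ℕ ℝ}
    (hM : ∀ j, M.col j ∈ X.carrier) {x : ℕ → ℝ} {y : X.Elem}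
    (h : HasSum (fun j => x j • colElem X M hM j) y) : MatrixMapsTo M x y := fun i => by
  refine (X.hasSum_coord h i).tendsto_sum_nat.congr fun k => Finset.sum_congr rfl fun j _ => ?_
  exact mul_comm (x j) (M i j)

theorem MatrixMapsTo.unique {X : KotheSequenceSpace} {M : Matrix ℕ ℕ ℝ} {x : ℕ → ℝ}
    {y z : X.Elem} (hy : MatrixMapsTo M x y) (hz : MatrixMapsTo M x z) : y = z :=
  Subtype.ext (funext fun i => tendsto_nhds_unique (hy i) (hz i))

/-- Finitely supported vectors lie in `ℓ¹`, where `S` must agree with the column sum. The added 1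
keeps the constant positive even if `S = 0`. -/
theorem hasUpperEstimate_of_extension (X : KotheSequenceSpace) (M : Matrix ℕ ℕ ℝ)
    (hM : ∀ j, M.col j ∈ X.carrier) (p : ℝ≥0∞) [Fact (1 ≤ p)] (hp : 0 < p.toReal)
    (S : lp (fun _ : ℕ => ℝ) p →L[ℝ] X.Elem)
    (hS : ∀ x : lp (fun _ : ℕ => ℝ) p, Memℓp (x : ℕ → ℝ) 1 → MatrixMapsTo M x (S x)) :
    HasUpperEstimate (colElem X M hM) p.toReal (‖S‖ + 1) := by
  intro s x hx
  set y : lp (fun _ : ℕ => ℝ) p := ∑ j ∈ s, lp.single p j (x j) with hy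
  have hyi : ∀ i, y i = if i ∈ s then x i else 0 := lp_sum_single_apply s x
  have hy1 : Memℓp (y : ℕ → ℝ) 1 := by
    have h := lp.memℓp (∑ j ∈ s, (lp.single 1 j (x j) : lp (fun _ : ℕ => ℝ) 1))
    convert h using 1
    ext i
    rw [hyi, lp_sum_single_apply]
  have hsum : HasSum (fun j => y j • colElem X M hM j) (∑ j ∈ s, x j • colElem X M hM j) := by
    have h := hasSum_sum_of_ne_finset_zero (f := fun j => y j • colElem X M hM j) (s := s)
      (L := .unconditional ℕ) fun j hj => by rw [hyi, if_neg hj, zero_smul]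
    convert h using 1
    exact Finset.sum_congr rfl fun j hj => by simp [hyi, hj]
  rw [← (hS y hy1).unique (matrixMapsTo_of_hasSum hM hsum), ← lp_norm_sum_single hp s x hx, ← hy]
  refine (S.le_opNorm y).trans ?_
  gcongr
  linarith

theorem memL1_of_hasUpperEstimate (X : KotheSequenceSpace) (M : Matrix ℕ ℕ ℝ)
    (hM : ∀ j, M.col j ∈ X.carrier) (p : ℝ≥0∞) (hp : 0 < p.toReal) {C : ℝ}
    (h : HasUpperEstimate (colElem X M hM) p.toReal C) (hC : 0 < C) {x : ℕ → ℝ}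
    (hx : Memℓp x p) : (matrixMeasure X M hM).MemL1 x := by
  have hx' : Summable fun j => |x j| ^ p.toReal := hx.summable hp
  have hs : Summable fun j => x j • colElem X M hM j :=
    HasUpperEstimate.summable h hp hC hx'
  have hm : (fun j => x j • (matrixMeasure X M hM).toFun {j}) = fun j => x j • colElem X M hM j :=
    funext fun j => by rw [matrixMeasure_singleton]
  exact DeltaVectorMeasure.MemL1.of_summable (hm ▸ hs)

theorem mainTheorem10 (X : KotheSequenceSpace) (hX : X.FatouProperty)
    (M : Matrix ℕ ℕ ℝ) (hM0 : ∀ j, M.col j ≠ 0) (hM : ∀ j, M.col j ∈ X.carrier)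
    (hbdd : BddAbove (Set.range fun j => ‖colElem X M hM j‖))
    (p : ℝ≥0∞) [Fact (1 ≤ p)] (hp : 1 < p) (hp_top : p ≠ ∞) :
    List.TFAE [
      -- (a) `M` defines a continuous linear operator `ℓ^p → X`
      ∃ S : lp (fun _ : ℕ => ℝ) p →L[ℝ] X.Elem,
        ∀ x : lp (fun _ : ℕ => ℝ) p, MatrixMapsTo M x (S x),
      -- (b) the operator that `M` defines on `ℓ¹` has a continuous linear extension `ℓ^p → X`
      ∃ S : lp (fun _ : ℕ => ℝ) p →L[ℝ] X.Elem,
        ∀ x : lp (fun _ : ℕ => ℝ) p, Memℓp (x : ℕ → ℝ) 1 → MatrixMapsTo M x (S x),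
      -- (c) `ℓ^p ⊆ ℓ¹(m_M)`
      {x : ℕ → ℝ | Memℓp x p} ⊆ {x | (matrixMeasure X M hM).MemL1 x},
      -- (d) `ℓ¹ ⊆ ℓ^{1/p}(m_M) ∩ ℓ¹(m_M)`
      {x : ℕ → ℝ | Memℓp x 1} ⊆
        (matrixMeasure X M hM).powL1 (1 / p.toReal) ∩ {x | (matrixMeasure X M hM).MemL1 x},
      -- (e)
      ∃ C : ℝ, 0 < C ∧ ∀ (s : Finset ℕ) (x : ℕ → ℝ), (∀ j ∈ s, 0 ≤ x j) →
        ‖∑ j ∈ s, x j • colElem X M hM j‖ ≤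
          C * (∑ j ∈ s, x j ^ p.toReal) ^ (1 / p.toReal)] := by
  have hp0 : 0 < p.toReal := ENNReal.toReal_pos (zero_lt_one.trans hp).ne' hp_top
  tfae_have 1 → 2 := fun ⟨S, hS⟩ => ⟨S, fun x _ => hS x⟩
  tfae_have 2 → 5 := fun ⟨S, hS⟩ =>
    ⟨‖S‖ + 1, by positivity, hasUpperEstimate_of_extension X M hM p hp0 S hS⟩
  tfae_have 5 → 1 := fun ⟨C, hC, h⟩ => by
    obtain ⟨S, hS⟩ := HasUpperEstimate.exists_clm (v := colElem X M hM) h hp0 hC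
    exact ⟨S, fun x => matrixMapsTo_of_hasSum hM (hS x)⟩
  tfae_have 5 → 3 := fun ⟨C, hC, h⟩ => by
    simp only [Set.ofPred_subset_ofPred]
    intro x hx
    exact memL1_of_hasUpperEstimate X M hM p hp0 h hC hx
  tfae_have 3 → 4 := fun h => by
    simp only [Set.ofPred_subset_ofPred] at h
    simp only [Set.subset_inter_iff, Set.ofPred_subset_ofPred, DeltaVectorMeasure.powL1]
    rw [← forall_and]
    intro x
    rw [← imp_and]
    intro hx
    -- Hypothesis (c) is used twice: for `|x| ^ (1 / p)`, whose `p`-th power is `|x|`, and for `x`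
    -- itself, as `ℓ¹ ⊆ ℓ^p`.
    refine ⟨⟨DeltaVectorMeasure.measurable_loc_finiteSubsets x, h _ (memℓp_gen ?_)⟩,
      h _ (Memℓp.of_exponent_ge hx hp.le)⟩
    have h1 : Summable fun j => |x j| := by simpa using Memℓp.summable (by simp) hx
    refine h1.congr fun j => ?_
    rw [Real.norm_of_nonneg (by positivity), one_div, Real.rpow_inv_rpow (abs_nonneg _) hp0.ne']
  tfae_have 4 → 5 := fun h => by
    simp only [Set.subset_inter_iff, Set.ofPred_subset_ofPred, DeltaVectorMeasure.powL1] at h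
    refine exists_hasUpperEstimate_of_weakly_summable hp0 fun x hx hxp f => ?_
    -- The `ℓ^{1/p}(m_M)` half of (d), applied to `x ^ p ∈ ℓ¹`, puts `x` itself in `ℓ¹(m_M)`.
    have hx1 : Memℓp (fun j => x j ^ p.toReal) 1 := memℓp_gen <| by
      refine (hxp.summable hp0).congr fun j => ?_
      simp [abs_of_nonneg (Real.rpow_nonneg (hx j) _), abs_of_nonneg (hx j)]
    refine ((h.1 _ hx1).2.summable f).congr fun j => ?_
    rw [matrixMeasure_singleton, abs_of_nonneg (Real.rpow_nonneg (hx j) _), one_div,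
      Real.rpow_rpow_inv (hx j) hp0.ne', abs_mul, abs_of_nonneg (hx j)]
  tfae_finish
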